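/- Let $G=(V,E)$ be a finite simple graph on $V=\{1,\dots,n\}$ with $n\ge 2$, let $\mathcal N(i)$ be the set of neighbours of $i$, and let $\mathcal I(G)\subset\{0,1\}^n$ be the set of (indicator vectors of) independent sets of $G$. Let $W\in\mathbb R^n$ with $W_i\ge 1$ for all $i$, and $W_{\max}=\max_i W_i$. Let $P$ be the transition matrix of the following Markov chain on $\Omega=\mathcal I(G)\times\{0,1\}^n$. Given the state $(\sigma,a)$, the next state $(\sigma',a')$ is obtained from independent random choices at the nodes as follows. 1. Each node $i$ draws $r_i\in\{0,1\}$ uniformly at random and temporarily sets $a'_i=r_i$ if $a_j=0$ for all $j\in\mathcal N(i)$, and $a'_i=0$ otherwise. 2. If $\sigma_i=1$, then $(\sigma'_i,a'_i)$ is reset to $(0,0)$ with probability $1/W_i$ and to $(1,1)$ otherwise. Else, if $a_j=0$ for all $j\in\mathcal N(i)$, then $\sigma'_i=1$ if $a'_i=1$ and $a'_j=0$ for all $j\in\mathcal N(i)$ (with the final values $a'$), and $\sigma'_i=0$ if not. Otherwise $(\sigma'_i,a'_i)=(0,0)$. Let $\Omega'\subset\Omega$ be the recurrence class of $P$ that contains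 $(\mathbf 0,\mathbf 0)$, i.e. the set of states that communicate with $(\mathbf 0,\mathbf 0)$. For distributions $\nu,\mu$ on a finite set write $\|\nu-\mu\|_{TV}=\sum_x|\nu_x-\mu_x|$. Then $P$ has a unique stationary distribution $\pi$ on $\Omega'$, and for every $\varepsilon\in(0,1/2)$, every probability distribution $\mu$ on $\Omega'$ and every integer $\tau\ge T_{\mathrm{mix}}(\varepsilon,n,W_{\max})$, $$\|\mu P^{\tau}-\pi\|_{TV}<\varepsilon,\qquad\text{where}\quad T_{\mathrm{mix}}(\varepsilon,n,W_{\max})=4^{\,n4^{n+1}+1}\,W_{\max}^{6n}\,\log\!\left(\frac{4^{\,n4^{n}}\,W_{\max}^{n}}{2\varepsilon}\right).$$ -/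

import Mathlib

open scoped Matrix

namespace MediumAccess

/-- The independent sets `I(G)` of the interference graph, as 0/1 vectors (`true` is `1`). -/
abbrev IndepVec {n : ℕ} (G : SimpleGraph (Fin n)) : Type :=
  {σ : Fin n → Bool // ∀ i j, G.Adj i j → ¬ (σ i = true ∧ σ j = true)}

/-- The state space `Ω = I(G) × {0,1}ⁿ`: a state is a pair `(σ, a)` of the vector of successful
transmissions and the vector of attempted transmissions. -/
abbrev State {n : ℕ} (G : SimpleGraph (Fin n)) : Type :=
  IndepVec G × (Fin n → Bool)

/-- The state `(0, 0)`. -/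
def zeroState {n : ℕ} (G : SimpleGraph (Fin n)) : State G :=
  (⟨fun _ => false, fun _ _ _ h => Bool.noConfusion h.1⟩, fun _ => false)

variable {n : ℕ} (G : SimpleGraph (Fin n)) [DecidableRel G.Adj]

/-- `a j = 0` for every neighbour `j` of `i`. -/
def Quiet (a : Fin n → Bool) (i : Fin n) : Prop :=
  ∀ j, G.Adj i j → a j = false

instance (a : Fin n → Bool) (i : Fin n) : Decidable (Quiet G a i) :=
  inferInstanceAs (Decidable (∀ j, G.Adj i j → a j = false))

/-- The temporary attempt vector of the first step, from the fair coins `r`. -/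
def tempAttempt (x : State G) (r : Fin n → Bool) (i : Fin n) : Bool :=
  if Quiet G x.2 i then r i else false

/-- The new attempt vector `a'`, from the fair coins `r` and the release coins `d`
(`d i = true`, of probability `1 / W i`, makes a successful node `i` stop). -/
def nextAttempt (x : State G) (r d : Fin n → Bool) (i : Fin n) : Bool :=
  if x.1.1 i = true then !(d i)
  else if Quiet G x.2 i then tempAttempt G x r i
  else false

/-- The new vector `σ'` of successful transmissions. The contention of a node that was not
successful is decided with the final attempts `a'` of its neighbours. -/
def nextSuccess (x : State G) (r d : Fin n → Bool) (i : Fin n) : Bool :=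
  if x.1.1 i = true then !(d i)
  else if Quiet G x.2 i then
    decide (nextAttempt G x r d i = true ∧ Quiet G (nextAttempt G x r d) i)
  else false

theorem nextSuccess_le (x : State G) (r d : Fin n → Bool) (i : Fin n)
    (h : nextSuccess G x r d i = true) : nextAttempt G x r d i = true := by
  by_cases h1 : x.1.1 i = true
  · simpa [nextSuccess, nextAttempt, h1] using h
  · by_cases h2 : Quiet G x.2 i
    · simp [nextSuccess, h1, h2] at h
      exact h.1
    · simp [nextSuccess, h1, h2] at h

theorem nextSuccess_fresh (x : State G) (r d : Fin n → Bool) (i : Fin n)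
    (h1 : ¬ x.1.1 i = true) (h : nextSuccess G x r d i = true) :
    Quiet G (nextAttempt G x r d) i := by
  by_cases h2 : Quiet G x.2 i
  · simp [nextSuccess, h1, h2] at h
    exact h.2
  · simp [nextSuccess, h1, h2] at h

theorem nextSuccess_indep (x : State G) (r d : Fin n → Bool) (i j : Fin n) (hij : G.Adj i j) :
    ¬ (nextSuccess G x r d i = true ∧ nextSuccess G x r d j = true) := by
  rintro ⟨hi, hj⟩
  by_cases h1 : x.1.1 i = true
  · by_cases h2 : x.1.1 j = true
    · exact x.1.2 i j hij ⟨h1, h2⟩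
    · have h3 := nextSuccess_fresh G x r d j h2 hj i hij.symm
      rw [nextSuccess_le G x r d i hi] at h3
      exact Bool.noConfusion h3
  · have h3 := nextSuccess_fresh G x r d i h1 hi j hij
    rw [nextSuccess_le G x r d j hj] at h3
    exact Bool.noConfusion h3

/-- The state `(σ', a')` that follows `x = (σ, a)` for given outcomes of the coins. -/
def next (x : State G) (r d : Fin n → Bool) : State G :=
  (⟨nextSuccess G x r d, nextSuccess_indep G x r d⟩, nextAttempt G x r d)

/-- The probability of the outcomes `r`, `d` when all `2n` coins are independent,
`r i = true` has probability `1 / 2` and `d i = true` has probability `1 / W i`. -/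
noncomputable def coinProb (W : Fin n → ℝ) (r d : Fin n → Bool) : ℝ :=
  (∏ i, if r i = true then (1 / 2 : ℝ) else 1 - 1 / 2) *
    ∏ i, if d i = true then 1 / W i else 1 - 1 / W i

/-- The transition matrix `P` on `Ω`: the law of the next state. -/
noncomputable def P (W : Fin n → ℝ) : Matrix (State G) (State G) ℝ :=
  fun x y => ∑ r : Fin n → Bool, ∑ d : Fin n → Bool,
    if next G x r d = y then coinProb W r d else 0

/-- The recurrence class `Ω'`: the communicating class of `(0, 0)`. -/
def recClass (W : Fin n → ℝ) : Set (State G) :=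
  {x | (∃ k : ℕ, 0 < (P G W ^ k) (zeroState G) x) ∧ ∃ k : ℕ, 0 < (P G W ^ k) x (zeroState G)}

/-- `μ` is a probability distribution on `Ω'`, as a row vector on `Ω` that vanishes off `Ω'`. -/
def IsDistOnRecClass (W : Fin n → ℝ) (μ : State G → ℝ) : Prop :=
  (∀ x, 0 ≤ μ x) ∧ ∑ x, μ x = 1 ∧ ∀ x, x ∉ recClass G W → μ x = 0

/-- `π` is a stationary distribution of `P` on `Ω'`. -/
def IsStationaryOnRecClass (W : Fin n → ℝ) (π : State G → ℝ) : Prop :=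
  IsDistOnRecClass G W π ∧ π ᵥ* P G W = π

/-- The total variation distance, normalized as the full `ℓ¹` distance (without a factor
`1 / 2`). -/
def tvDist {Ω : Type*} [Fintype Ω] (ν μ : Ω → ℝ) : ℝ :=
  ∑ x, |ν x - μ x|

/-- `T_mix(ε, n, w) = 4 ^ (n 4 ^ (n+1) + 1) w ^ (6n) log (4 ^ (n 4 ^ n) w ^ n / (2 ε))`. -/
noncomputable def Tmix (ε : ℝ) (n : ℕ) (w : ℝ) : ℝ :=
  4 ^ (n * 4 ^ (n + 1) + 1) * w ^ (6 * n) * Real.log (4 ^ (n * 4 ^ n) * w ^ n / (2 * ε))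

end MediumAccess

/-! From every state, the single outcome in which all coins `r` show 0 and all release coins show 1
leads to `(0, 0)` in one step. Its probability is at least `δ = 1 / (2 W_max) ^ n`, so a whole
column of `P` is bounded below by `δ`. By Doeblin's argument (`Matrix.sum_abs_vecMul_le`), `P`
shrinks vectors of total mass 0 by the factor `1 - δ` in `ℓ¹`. This gives a stationary `π` as the
limit of the laws started at `(0, 0)`, its uniqueness, and the bound `2 exp (-δ τ)` on the distance
at time `τ`. The stated `Tmix` is far larger than this bound requires. -/

open Filter Topology in
theorem Matrix.exists_stationary_of_contraction {Ω : Type*} [Fintype Ω] [DecidableEq Ω]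
    {M : Matrix Ω Ω ℝ} {z : Ω} {δ : ℝ}
    (hcontr : ∀ ν : Ω → ℝ, ∑ x, ν x = 0 → ∑ y, |(ν ᵥ* M) y| ≤ (1 - δ) * ∑ x, |ν x|)
    (hM0 : ∀ x y, 0 ≤ M x y) (hM1 : ∀ x, ∑ y, M x y = 1) (hδ0 : 0 < δ) (hδ1 : δ ≤ 1) :
    ∃ π : Ω → ℝ, (∀ x, 0 ≤ π x) ∧ ∑ x, π x = 1 ∧ π ᵥ* M = π ∧
      ∀ x, (∀ k : ℕ, (M ^ k) z x = 0) → π x = 0 := by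
  have hMS : M ∈ Matrix.rowStochastic ℝ Ω :=
    Matrix.mem_rowStochastic_iff_sum.2 ⟨hM0, hM1⟩
  have hS : ∀ k, M ^ k ∈ Matrix.rowStochastic ℝ Ω := fun k => pow_mem hMS k
  have hS1 : ∀ k, ∑ x, (M ^ k) z x = 1 := fun k =>
    (Matrix.mem_rowStochastic_iff_sum.1 (hS k)).2 z
  have hsucc : ∀ k : ℕ, (M ^ k) z ᵥ* M = (M ^ (k + 1)) z := fun k => by
    funext y
    rw [pow_succ, Matrix.mul_apply]
    rfl
  -- Consecutive laws differ by a vector of mass 0, so the contraction makes the increments decay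
  -- geometrically.
  have hl1 : ∀ k : ℕ, ∑ x, |(M ^ k) z x - (M ^ (k + 1)) z x| ≤
      (∑ x, |(M ^ 0) z x - (M ^ (0 + 1)) z x|) * (1 - δ) ^ k := by
    intro k
    induction k with
    | zero => simp
    | succ k ih =>
      have h := hcontr ((M ^ k) z - (M ^ (k + 1)) z) (by simp [hS1])
      rw [Matrix.sub_vecMul, hsucc, hsucc] at h
      simp only [Pi.sub_apply] at h
      calc _ ≤ _ := h
        _ ≤ _ := mul_le_mul_of_nonneg_left ih (by linarith)
        _ = _ := by ring
  have hcauchy : CauchySeq fun k : ℕ => (M ^ k) z := by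
    refine cauchySeq_of_le_geometric (1 - δ) (∑ x, |(M ^ 0) z x - (M ^ (0 + 1)) z x|)
      (by linarith) fun k => ?_
    refine le_trans ?_ (hl1 k)
    refine (dist_pi_le_iff (Finset.sum_nonneg fun _ _ => abs_nonneg _)).2 fun x => ?_
    rw [Real.dist_eq]
    exact Finset.single_le_sum (f := fun x => |(M ^ k) z x - (M ^ (k + 1)) z x|)
      (fun _ _ => abs_nonneg _) (Finset.mem_univ x)
  obtain ⟨π, hπ⟩ := cauchySeq_tendsto_of_complete hcauchy
  have hπx : ∀ x, Tendsto (fun k : ℕ => (M ^ k) z x) atTop (𝓝 (π x)) :=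
    fun x => (tendsto_pi_nhds.1 hπ) x
  refine ⟨π, fun x => ge_of_tendsto' (hπx x) fun k =>
    (Matrix.mem_rowStochastic_iff_sum.1 (hS k)).1 z x, ?_, ?_, fun x hx => ?_⟩
  · refine tendsto_nhds_unique (tendsto_finsetSum Finset.univ fun x _ => hπx x) ?_
    simp only [hS1]
    exact tendsto_const_nhds
  · have h1 : Tendsto (fun k : ℕ => (M ^ k) z ᵥ* M) atTop (𝓝 (π ᵥ* M)) :=
      ((continuous_id.matrix_vecMul continuous_const).tendsto π).comp hπ
    simp only [hsucc] at h1
    exact tendsto_nhds_unique h1 (hπ.comp (tendsto_add_atTop_nat 1))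
  · refine tendsto_nhds_unique (hπx x) ?_
    simp only [hx]
    exact tendsto_const_nhds

/-- Doeblin's contraction: if all entries of the column `z` of a stochastic matrix are at
least `δ`, then vectors of total mass `0` contract by the factor `1 - δ` in `ℓ¹`. -/
theorem Matrix.sum_abs_vecMul_le {Ω : Type*} [Fintype Ω] [DecidableEq Ω]
    {M : Matrix Ω Ω ℝ} {z : Ω} {δ : ℝ} (hM0 : ∀ x y, 0 ≤ M x y)
    (hM1 : ∀ x, ∑ y, M x y = 1) (hδ : ∀ x, δ ≤ M x z) (ν : Ω → ℝ) (hν : ∑ x, ν x = 0) :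
    ∑ y, |(ν ᵥ* M) y| ≤ (1 - δ) * ∑ x, |ν x| := by
  have hN : ∀ x y, 0 ≤ M x y - (if y = z then δ else 0) := by
    intro x y
    split_ifs with h
    · subst h
      linarith [hδ x]
    · linarith [hM0 x y]
  -- Since `ν` has mass 0, removing the constant `δ` from column `z` does not change `ν ᵥ* M`; the
  -- remaining matrix is nonnegative with row sums `1 - δ`.
  have hrow : ∀ y, (ν ᵥ* M) y = ∑ x, ν x * (M x y - if y = z then δ else 0) := by
    intro y
    simp only [mul_sub, Finset.sum_sub_distrib, ← Finset.sum_mul, hν, zero_mul, sub_zero]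
    rfl
  calc ∑ y, |(ν ᵥ* M) y|
      ≤ ∑ y, ∑ x, |ν x| * (M x y - if y = z then δ else 0) := by
        refine Finset.sum_le_sum fun y _ => ?_
        rw [hrow]
        refine (Finset.abs_sum_le_sum_abs _ _).trans (Finset.sum_le_sum fun x _ => ?_)
        rw [abs_mul, abs_of_nonneg (hN x y)]
    _ = (1 - δ) * ∑ x, |ν x| := by
        rw [Finset.sum_comm, Finset.mul_sum]
        refine Finset.sum_congr rfl fun x _ => ?_
        rw [← Finset.mul_sum, Finset.sum_sub_distrib, hM1]
        simp [mul_comm]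

theorem Matrix.sum_vecMul_of_row_sum_one {Ω : Type*} [Fintype Ω]
    {M : Matrix Ω Ω ℝ} (hM1 : ∀ x, ∑ y, M x y = 1) (ν : Ω → ℝ) :
    ∑ y, (ν ᵥ* M) y = ∑ x, ν x := by
  simp only [Matrix.vecMul, dotProduct]
  rw [Finset.sum_comm]
  simp only [← Finset.mul_sum, hM1, mul_one]

theorem Matrix.sum_abs_vecMul_pow_le {Ω : Type*} [Fintype Ω] [DecidableEq Ω]
    {M : Matrix Ω Ω ℝ} {δ : ℝ}
    (hcontr : ∀ ν : Ω → ℝ, ∑ x, ν x = 0 → ∑ y, |(ν ᵥ* M) y| ≤ (1 - δ) * ∑ x, |ν x|)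
    (hM1 : ∀ x, ∑ y, M x y = 1) (hδ1 : δ ≤ 1)
    (k : ℕ) (ν : Ω → ℝ) (hν : ∑ x, ν x = 0) :
    ∑ y, |(ν ᵥ* M ^ k) y| ≤ (1 - δ) ^ k * ∑ x, |ν x| := by
  induction k generalizing ν with
  | zero => simp
  | succ k ih =>
    rw [pow_succ', ← Matrix.vecMul_vecMul]
    refine (ih _ (by rw [Matrix.sum_vecMul_of_row_sum_one hM1, hν])).trans ?_
    rw [pow_succ, mul_assoc]
    exact mul_le_mul_of_nonneg_left (hcontr ν hν) (pow_nonneg (by linarith) k)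

theorem Matrix.vecMul_pow_of_vecMul_eq {Ω : Type*} [Fintype Ω] [DecidableEq Ω]
    {M : Matrix Ω Ω ℝ} {π : Ω → ℝ} (h : π ᵥ* M = π) (k : ℕ) : π ᵥ* M ^ k = π := by
  induction k with
  | zero => simp
  | succ k ih => rw [pow_succ', ← Matrix.vecMul_vecMul, h, ih]

namespace MediumAccess

section Chain

variable {n : ℕ} (G : SimpleGraph (Fin n)) [DecidableRel G.Adj] {W : Fin n → ℝ}

theorem coinProb_nonneg (hW : ∀ i, 1 ≤ W i) (r d : Fin n → Bool) : 0 ≤ coinProb W r d := by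
  refine mul_nonneg (Finset.prod_nonneg fun i _ => ?_) (Finset.prod_nonneg fun i _ => ?_)
  · split_ifs <;> norm_num
  · have h0 : (0 : ℝ) < W i := by linarith [hW i]
    have h1 : 1 / W i ≤ 1 := (div_le_one h0).2 (hW i)
    split_ifs
    · positivity
    · linarith

theorem sum_coinProb : ∑ r : Fin n → Bool, ∑ d : Fin n → Bool, coinProb W r d = 1 := by
  simp only [coinProb, ← Finset.mul_sum, ← Finset.sum_mul]
  have h : ∀ p : Fin n → ℝ,
      ∑ r : Fin n → Bool, ∏ i, (if r i = true then p i else 1 - p i) = 1 := by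
    intro p
    rw [← Fintype.prod_sum fun i (b : Bool) => if b = true then p i else 1 - p i]
    simp
  rw [h fun _ => 1 / 2, h fun i => 1 / W i, one_mul]

theorem P_nonneg (hW : ∀ i, 1 ≤ W i) (x y : State G) : 0 ≤ P G W x y :=
  Finset.sum_nonneg fun r _ => Finset.sum_nonneg fun d _ => by
    split_ifs
    · exact coinProb_nonneg hW r d
    · exact le_rfl

theorem sum_P (x : State G) : ∑ y, P G W x y = 1 := by
  simp only [P]
  rw [Finset.sum_comm, ← sum_coinProb (W := W)]
  refine Finset.sum_congr rfl fun r _ => ?_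
  rw [Finset.sum_comm]
  exact Finset.sum_congr rfl fun d _ => by simp

/-- If no idle node attempts and every successful node stops, the next state is `(0, 0)`. -/
theorem next_eq_zeroState (x : State G) :
    next G x (fun _ => false) (fun _ => true) = zeroState G := by
  have ha : nextAttempt G x (fun _ => false) (fun _ => true) = fun _ => false := by
    funext i
    simp [nextAttempt, tempAttempt]
  refine Prod.ext (Subtype.ext (funext fun i => ?_)) ha
  simp [next, zeroState, nextSuccess, ha]

theorem le_P_zeroState (hW : ∀ i, 1 ≤ W i) {w : ℝ} (hw : ∀ i, W i ≤ w) (x : State G) :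
    1 / (2 * w) ^ n ≤ P G W x (zeroState G) := by
  have hterm : ∀ r d : Fin n → Bool,
      0 ≤ if next G x r d = zeroState G then coinProb W r d else 0 := fun r d => by
    split_ifs
    · exact coinProb_nonneg hW r d
    · exact le_rfl
  calc 1 / (2 * w) ^ n ≤ coinProb W (fun _ => false) (fun _ => true) := by
        have h : ∏ _i : Fin n, 1 / w ≤ ∏ i, 1 / W i :=
          Finset.prod_le_prod
            (fun i _ => one_div_nonneg.2 (by linarith [hW i, hw i]))
            fun i _ => one_div_le_one_div_of_le (by linarith [hW i]) (hw i)
        have hc : coinProb W (fun _ => false) (fun _ => true) =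
            (1 / 2) ^ n * ∏ i, 1 / W i := by
          norm_num only [coinProb, Bool.false_eq_true, if_true, if_false, Finset.prod_const,
            Finset.card_univ, Fintype.card_fin]
        rw [hc]
        refine le_trans (le_of_eq ?_) (mul_le_mul_of_nonneg_left h (by positivity))
        simp [mul_pow, mul_comm]
    _ = if next G x (fun _ => false) (fun _ => true) = zeroState G then
          coinProb W (fun _ => false) (fun _ => true) else 0 := by
        rw [if_pos (next_eq_zeroState G x)]
    _ ≤ ∑ d, if next G x (fun _ => false) d = zeroState G then
          coinProb W (fun _ => false) d else 0 :=
        Finset.single_le_sum (f := fun d => if next G x (fun _ => false) d = zeroState G then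
          coinProb W (fun _ => false) d else 0) (fun d _ => hterm _ d) (Finset.mem_univ _)
    _ ≤ P G W x (zeroState G) :=
        Finset.single_le_sum (f := fun r => ∑ d, if next G x r d = zeroState G then
          coinProb W r d else 0) (fun r _ => Finset.sum_nonneg fun d _ => hterm r d)
          (Finset.mem_univ _)

end Chain

/-- The prefactor of `Tmix` exceeds `(2 * w) ^ n`, so the exponent is at least the logarithm and the
left side is at most `4 * ε / B`, with `B ≥ 16`. -/
theorem two_mul_exp_neg_lt_of_Tmix_le {n : ℕ} (hn : 2 ≤ n) {w ε t : ℝ} (hw : 1 ≤ w)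
    (hε : 0 < ε) (hε1 : ε < 1 / 2) (ht : Tmix ε n w ≤ t) :
    2 * Real.exp (-(1 / (2 * w) ^ n * t)) < ε := by
  have hw0 : 0 < w := by linarith
  have hA : (16 : ℝ) ≤ 4 ^ (n * 4 ^ n) := by
    have h : 2 ≤ n * 4 ^ n := hn.trans (Nat.le_mul_of_pos_right n (by positivity))
    calc (16 : ℝ) = 4 ^ 2 := by norm_num
      _ ≤ _ := pow_le_pow_right₀ (by norm_num) h
  have hwn : 1 ≤ w ^ n := one_le_pow₀ hw
  have hAw : 16 ≤ (4 : ℝ) ^ (n * 4 ^ n) * w ^ n := by nlinarith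
  set B := (4 : ℝ) ^ (n * 4 ^ n) * w ^ n with hB
  -- The sign is needed to multiply `hcoef` by the logarithm; it holds as `2 * ε < 1 ≤ B`.
  have hL : 0 ≤ Real.log (B / (2 * ε)) :=
    Real.log_nonneg ((one_le_div (by positivity)).2 (by linarith))
  have hcoef : (2 * w) ^ n ≤ 4 ^ (n * 4 ^ (n + 1) + 1) * w ^ (6 * n) := by
    rw [mul_pow]
    refine mul_le_mul ?_ (pow_le_pow_right₀ hw (by omega)) (by positivity) (by positivity)
    have h : n ≤ n * 4 ^ (n + 1) + 1 :=
      (Nat.le_mul_of_pos_right n (by positivity)).trans (Nat.le_succ _)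
    calc (2 : ℝ) ^ n ≤ 4 ^ n := pow_le_pow_left₀ (by norm_num) (by norm_num) n
      _ ≤ _ := pow_le_pow_right₀ (by norm_num) h
  have hexp : Real.log (B / (2 * ε)) ≤ 1 / (2 * w) ^ n * t := by
    rw [one_div_mul_eq_div, le_div_iff₀ (by positivity), mul_comm]
    exact (mul_le_mul_of_nonneg_right hcoef hL).trans ht
  calc 2 * Real.exp (-(1 / (2 * w) ^ n * t))
      ≤ 2 * Real.exp (-Real.log (B / (2 * ε))) := by gcongr
    _ = 4 * ε / B := by
        rw [Real.exp_neg, Real.exp_log (by positivity), inv_div]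
        ring
    _ < ε := by
        rw [div_lt_iff₀ (by positivity)]
        nlinarith

end MediumAccess

open MediumAccess in
-- The return to `(0, 0)` always has positive probability in one step, so reachability from `(0, 0)`
-- suffices.
theorem MediumAccess.mem_recClass_of_pow_pos {n : ℕ} {G : SimpleGraph (Fin n)}
    [DecidableRel G.Adj] {W : Fin n → ℝ} (hW : ∀ i, 1 ≤ W i) {w : ℝ} (hw0 : 0 < w)
    (hw : ∀ i, W i ≤ w) {k : ℕ} {x : State G} (h : 0 < (P G W ^ k) (zeroState G) x) :
    x ∈ recClass G W :=
  ⟨⟨k, h⟩, 1, by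
    rw [pow_one]
    exact lt_of_lt_of_le (by positivity) (le_P_zeroState G hW hw x)⟩

theorem lemma2 (n : ℕ) (hn : 2 ≤ n) (G : SimpleGraph (Fin n)) [DecidableRel G.Adj]
    (W : Fin n → ℝ) (hW : ∀ i, 1 ≤ W i) :
    ∃ π : MediumAccess.State G → ℝ,
      MediumAccess.IsStationaryOnRecClass G W π ∧
      (∀ π' : MediumAccess.State G → ℝ,
        MediumAccess.IsStationaryOnRecClass G W π' → π' = π) ∧
      ∀ ε : ℝ, 0 < ε → ε < 1 / 2 →
        ∀ μ : MediumAccess.State G → ℝ, MediumAccess.IsDistOnRecClass G W μ →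
          ∀ τ : ℕ, MediumAccess.Tmix ε n (⨆ i, W i) ≤ (τ : ℝ) →
            MediumAccess.tvDist (μ ᵥ* MediumAccess.P G W ^ τ) π < ε := by
  have hw : ∀ i, W i ≤ ⨆ i, W i := le_ciSup (Set.finite_range W).bddAbove
  set w := ⨆ i, W i
  have hw1 : 1 ≤ w := (hW ⟨0, by omega⟩).trans (hw _)
  have hw0 : 0 < w := by linarith
  set δ : ℝ := 1 / (2 * w) ^ n with hδ
  have hδ0 : 0 < δ := by positivity
  have hδ1 : δ ≤ 1 := by
    rw [hδ, div_le_one (by positivity)]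
    exact one_le_pow₀ (by linarith)
  have hP0 := MediumAccess.P_nonneg G hW
  have hP1 := MediumAccess.sum_P G (W := W)
  have hcontr := Matrix.sum_abs_vecMul_le hP0 hP1 (MediumAccess.le_P_zeroState G hW hw)
  obtain ⟨π, hπ0, hπ1, hπP, hπz⟩ :=
    Matrix.exists_stationary_of_contraction (z := MediumAccess.zeroState G) hcontr hP0 hP1 hδ0 hδ1
  have hpow0 : ∀ (k : ℕ) x y, 0 ≤ (MediumAccess.P G W ^ k) x y := fun k =>
    (Matrix.mem_rowStochastic_iff_sum.1
      (pow_mem (Matrix.mem_rowStochastic_iff_sum.2 ⟨hP0, hP1⟩) k)).1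
  refine ⟨π, ⟨⟨hπ0, hπ1, fun x hx => hπz x fun k => ?_⟩, hπP⟩, ?_, ?_⟩
  · by_contra hne
    exact hx (MediumAccess.mem_recClass_of_pow_pos hW hw0 hw
      (lt_of_le_of_ne (hpow0 k _ x) (Ne.symm hne)))
  · rintro π' ⟨⟨-, hπ'1, -⟩, hπ'P⟩
    have h := hcontr (π' - π) (by simp [hπ'1, hπ1])
    rw [Matrix.sub_vecMul, hπ'P, hπP] at h
    -- The difference is fixed by `P`, so its norm `s` satisfies `s ≤ (1 - δ) * s` with `δ > 0`.
    have hzero : ∑ x, |(π' - π) x| = 0 :=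
      le_antisymm (by nlinarith) (Finset.sum_nonneg fun _ _ => abs_nonneg _)
    funext x
    have hx := (Finset.sum_eq_zero_iff_of_nonneg fun _ _ => abs_nonneg _).1 hzero x
      (Finset.mem_univ x)
    exact sub_eq_zero.1 (abs_eq_zero.1 hx)
  · rintro ε hε hε1 μ ⟨hμ0, hμ1, -⟩ τ hτ
    have h := Matrix.sum_abs_vecMul_pow_le hcontr hP1 hδ1 τ (μ - π) (by simp [hμ1, hπ1])
    -- Stationarity turns `(μ - π) P ^ τ` into `μ P ^ τ - π`.
    rw [Matrix.sub_vecMul, Matrix.vecMul_pow_of_vecMul_eq hπP] at h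
    have hdist : ∑ x, |(μ - π) x| ≤ 2 :=
      calc ∑ x, |(μ - π) x| ≤ ∑ x, (μ x + π x) := Finset.sum_le_sum fun x _ => by
            rw [Pi.sub_apply, abs_le]
            constructor <;> linarith [hμ0 x, hπ0 x]
        _ = 2 := by
            rw [Finset.sum_add_distrib, hμ1, hπ1]
            norm_num
    have hexp : (1 - δ) ^ τ ≤ Real.exp (-(δ * τ)) := by
      calc (1 - δ) ^ τ ≤ Real.exp (-δ) ^ τ :=
            pow_le_pow_left₀ (by linarith) (Real.one_sub_le_exp_neg δ) τ
        _ = Real.exp (-(δ * τ)) := by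
            rw [← Real.exp_nat_mul]
            ring_nf
    calc MediumAccess.tvDist (μ ᵥ* MediumAccess.P G W ^ τ) π
        ≤ (1 - δ) ^ τ * ∑ x, |(μ - π) x| := h
      _ ≤ Real.exp (-(δ * τ)) * 2 :=
          mul_le_mul hexp hdist (Finset.sum_nonneg fun _ _ => abs_nonneg _) (Real.exp_pos _).le
      _ = 2 * Real.exp (-(δ * τ)) := mul_comm _ _
      _ < ε := MediumAccess.two_mul_exp_neg_lt_of_Tmix_le hn hw1 hε hε1 hτ
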